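/- Let $G$ be a finite simple connected $d$-regular graph with $d \ge 5$ and girth $g \ge 4$, let $r = \lfloor g/2 \rfloor$, and let $\lambda$ be the second largest eigenvalue of the adjacency matrix of $G$ (counted with multiplicity; for a $d$-regular graph, connectedness is equivalent to $\lambda < d$). For real $x$ put $$n_0(x,g) = \begin{cases} 1 + x\sum_{i=0}^{r-1}(x-1)^i & \text{if } g = 2r+1,\\ 2\sum_{i=0}^{r-1}(x-1)^i & \text{if } g = 2r.\end{cases}$$ The cyclic edge-connectivity of $G$ is the least $|S|$ over all sets $S$ of edges of $G$ such that $G - S$ is disconnected and every connected component of $G - S$ contains a cycle. If $$\frac{2(d-2)g}{d-\lambda} \le n_0\Bigl(d - \frac{2}{r-1},\, g\Bigr),$$ then the cyclic edge-connectivity of $G$ exists and equals $(d-2)g$. Moreover, the value is attained by the cut around a shortest cycle: there is a cycle $C$ of length $g$ in $G$ such that the set $E(C,\overline{C})$ of edges between the vertices of $C$ and the other vertices has exactly $(d-2)g$ elements, and $G - E(C,\overline{C})$ is disconnected with every component containing a cycle. -/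

import Mathlib

namespace SimpleGraph

/-- The set `E(X, Y)` of edges of `G` between the vertex sets `X` and `Y`. -/
def edgesBetween {V : Type*} (G : SimpleGraph V) (X Y : Set V) : Set (Sym2 V) :=
  {e | ∃ x ∈ X, ∃ y ∈ Y, G.Adj x y ∧ e = s(x, y)}

/-- `S` is a set of edges of `G` such that `G - S` is disconnected and every connected component
of `G - S` contains a cycle. -/
def IsCyclicEdgeCut {V : Type*} (G : SimpleGraph V) (S : Set (Sym2 V)) : Prop :=
  S ⊆ G.edgeSet ∧ ¬ (G.deleteEdges S).Preconnected ∧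
    ∀ c : (G.deleteEdges S).ConnectedComponent,
      ∃ v ∈ c, ∃ w : (G.deleteEdges S).Walk v v, w.IsCycle

/-- The cyclic edge-connectivity: the least size of a cyclic edge cut
(`⊤` if there is no cyclic edge cut). -/
noncomputable def cyclicEdgeConnectivity {V : Type*} (G : SimpleGraph V) : ℕ∞ :=
  ⨅ (S : Set (Sym2 V)) (_ : G.IsCyclicEdgeCut S), S.encard

/-- The second largest eigenvalue, counted with multiplicity, of the adjacency matrix of a finite
graph with at least two vertices (and `0` if there are fewer than two vertices).
`eigenvalues₀` lists the eigenvalues with multiplicity in non-increasing order, from index `0`. -/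
noncomputable def secondLargestEigenvalue {V : Type*} [Fintype V] [DecidableEq V]
    (G : SimpleGraph V) [DecidableRel G.Adj] : ℝ :=
  if h : 1 < Fintype.card V then (G.isHermitian_adjMatrix ℝ).eigenvalues₀ ⟨1, h⟩ else 0

end SimpleGraph

/-- The Moore function `n₀(d, g)` for a real degree `d`: it is `1 + d ∑_{i < r} (d - 1) ^ i` if
`g = 2 r + 1`, and `2 ∑_{i < r} (d - 1) ^ i` if `g = 2 r`. -/
noncomputable def mooreBound (d : ℝ) (g : ℕ) : ℝ :=
  if Odd g then 1 + d * ∑ i ∈ Finset.range (g / 2), (d - 1) ^ i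
  else 2 * ∑ i ∈ Finset.range (g / 2), (d - 1) ^ i

/-! ### Short paths and the girth -/

namespace SimpleGraph

/-! Upper bound: let `C` be a shortest cycle. As `g ≥ 4`, every vertex has at most two neighbours on
`C`, since a third would close a shorter cycle. So the cut around `C` has exactly `(d - 2) g` edges,
and minimum degree at least two survives on both sides, which puts a cycle in every component.

Lower bound: given a cyclic cut `S`, one component of `G - S` or its complement has at most half of
the vertices; call it `X`. It contains a cycle, and its boundary lies in `S`. Deleting vertices with
at most one neighbour inside never increases the boundary and spares the cycle, so there remains a
set `Y` of minimum inner degree two. Let `k = |Y|`, let `c` be its boundary and `a = d - c / k` its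
average inner degree. Two estimates are played against each other: the spectral gap gives `(d - λ) k
≤ 2 c` (`mul_card_mul_card_le_boundarySize`), and the Alon–Hoory–Linial bound gives `n₀(a, g) ≤ k`
(`mooreBound_averageDegree_le_card`). If `a > d - 2 / (r - 1)`, the hypothesis makes `k` large and
the spectral estimate suffices. Otherwise `c = k (d - a) ≥ (d - a) n₀(a, g)`, and the tangent of
`n₀` at degree 2 gives `c ≥ (d - 2) g`. -/

/-- Paths in an acyclic graph are unique, so the union of the two paths contains a cycle. That cycle
repeats no edge, hence is no longer than both paths together. -/
theorem egirth_le_length_add_length {V : Type*} {G : SimpleGraph V} {u v : V} {p q : G.Walk u v}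
    (hp : p.IsPath) (hq : q.IsPath) (hne : p ≠ q) : G.egirth ≤ (p.length + q.length : ℕ) := by
  classical
  let H : SimpleGraph V := fromEdgeSet {e | e ∈ p.edges ∨ e ∈ q.edges}
  have hmem : ∀ e ∈ G.edgeSet, (e ∈ p.edges ∨ e ∈ q.edges) → e ∈ H.edgeSet := by
    intro e he h
    rw [edgeSet_fromEdgeSet]
    exact ⟨h, G.not_isDiag_of_mem_edgeSet he⟩
  have hpe : ∀ e ∈ p.edges, e ∈ H.edgeSet :=
    fun e he => hmem e (p.edges_subset_edgeSet he) (Or.inl he)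
  have hqe : ∀ e ∈ q.edges, e ∈ H.edgeSet :=
    fun e he => hmem e (q.edges_subset_edgeSet he) (Or.inr he)
  have hle : H ≤ G := by
    intro a b hab
    rcases ((fromEdgeSet_adj _).1 hab).1 with h | h
    · exact p.edges_subset_edgeSet h
    · exact q.edges_subset_edgeSet h
  have hcyc : ¬ H.IsAcyclic := by
    intro hac
    have h := congrArg Subtype.val
      ((hac.subsingleton_path _ _).elim ⟨p.transfer H hpe, hp.transfer hpe⟩
        ⟨q.transfer H hqe, hq.transfer hqe⟩)
    have h2 := congrArg Walk.support h
    simp only [Walk.support_transfer] at h2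
    exact hne (Walk.ext_support h2)
  simp only [IsAcyclic, not_forall, not_not] at hcyc
  obtain ⟨a, w, hw⟩ := hcyc
  refine (egirth_le_length (hw.mapLe hle)).trans ?_
  have hsub : w.edges ⊆ p.edges ++ q.edges := by
    intro e he
    have := w.edges_subset_edgeSet he
    rw [edgeSet_fromEdgeSet] at this
    exact List.mem_append.2 this.1
  have := (List.subperm_of_subset hw.edges_nodup hsub).length_le
  simp only [List.length_append, Walk.length_edges] at this
  simp only [Walk.length_map, Walk.mapLe]
  exact_mod_cast this

theorem Walk.IsPath.eq_of_length_add_lt_egirth {V : Type*} {G : SimpleGraph V} {g : ℕ}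
    (hg : (g : ℕ∞) ≤ G.egirth) {u v : V} {p q : G.Walk u v}
    (hp : p.IsPath) (hq : q.IsPath) (hlt : p.length + q.length < g) : p = q := by
  by_contra hne
  have := hg.trans (egirth_le_length_add_length hp hq hne)
  have : g ≤ p.length + q.length := by exact_mod_cast this
  omega

/-! ### Counting non-backtracking walks below the girth -/

section Moore

variable {V : Type*} [Fintype V] [DecidableEq V] (G : SimpleGraph V) [DecidableRel G.Adj]

/-- The end points of the non-backtracking walks with `i + 1` edges whose first step is from `u`
to `v`. -/
def branch : ℕ → V → V → Finset V
  | 0, _, v => {v}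
  | i + 1, u, v => ((G.neighborFinset v).erase u).biUnion fun w => branch i v w

/-- The number of non-backtracking walks with `i + 1` edges whose first step is from `u` to `v`. -/
def branchCount : ℕ → V → V → ℕ
  | 0, _, _ => 1
  | i + 1, u, v => ∑ w ∈ (G.neighborFinset v).erase u, branchCount i v w

variable {G} {g : ℕ}

theorem exists_isPath_of_mem_branch (hg : (g : ℕ∞) ≤ G.egirth) {x : V} :
    ∀ {i : ℕ} {u v : V} (h : G.Adj u v), i + 1 < g → x ∈ G.branch i u v →
      ∃ p : G.Walk v x, p.length = i ∧ (Walk.cons h p).IsPath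
  | 0, u, v, h, _, hx => by
    simp only [branch, Finset.mem_singleton] at hx
    subst hx
    exact ⟨Walk.nil, rfl, by simp [Walk.cons_isPath_iff, h.ne]⟩
  | i + 1, u, v, h, hi, hx => by
    simp only [branch, Finset.mem_biUnion, Finset.mem_erase, mem_neighborFinset] at hx
    obtain ⟨w, ⟨hwu, hvw⟩, hx⟩ := hx
    obtain ⟨q, hql, hq⟩ := exists_isPath_of_mem_branch hg hvw (by omega) hx
    refine ⟨Walk.cons hvw q, by simp [hql], ?_⟩
    rw [Walk.cons_isPath_iff]
    refine ⟨hq, fun hu => ?_⟩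
    have hP := hq.takeUntil hu
    have hE : (Walk.cons h.symm Walk.nil : G.Walk v u).IsPath := by
      simp [Walk.cons_isPath_iff, h.ne']
    have hlen := (Walk.cons hvw q).length_takeUntil_le_length hu
    -- If the walk returned to `u`, its part from `v` to `u` and the edge `vu` would be two short
    -- paths, hence equal, and the walk would backtrack.
    have := Walk.IsPath.eq_of_length_add_lt_egirth hg hP hE (by
      simp only [Walk.length_cons, Walk.length_nil, hql] at hlen ⊢
      omega)
    have h2 := congrArg Walk.snd this
    rw [Walk.snd_takeUntil h.ne] at h2
    simp at h2
    exact hwu h2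

/-- A common end point would give two different paths of total length below the girth; the other
disjointness lemmas rest on the same uniqueness. -/
theorem disjoint_branch_of_ne (hg : (g : ℕ∞) ≤ G.egirth) {i j : ℕ} {v w w' : V} (h : G.Adj v w)
    (h' : G.Adj v w') (hne : w ≠ w') (hij : i + j + 2 < g) :
    Disjoint (G.branch i v w) (G.branch j v w') := by
  rw [Finset.disjoint_left]
  intro x hx hx'
  obtain ⟨p, hp, hpp⟩ := exists_isPath_of_mem_branch hg h (by omega) hx
  obtain ⟨q, hq, hqp⟩ := exists_isPath_of_mem_branch hg h' (by omega) hx'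
  have := Walk.IsPath.eq_of_length_add_lt_egirth hg hpp hqp (by
    simp only [Walk.length_cons]; omega)
  have h2 := congrArg Walk.snd this
  simp at h2
  exact hne h2

theorem disjoint_branch_of_length_ne (hg : (g : ℕ∞) ≤ G.egirth) {i j : ℕ} {u v : V}
    (h : G.Adj u v) (hne : i ≠ j) (hi : i + 1 < g) (hj : j + 1 < g) (hij : i + j < g) :
    Disjoint (G.branch i u v) (G.branch j u v) := by
  rw [Finset.disjoint_left]
  intro x hx hx'
  obtain ⟨p, hp, hpp⟩ := exists_isPath_of_mem_branch hg h hi hx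
  obtain ⟨q, hq, hqp⟩ := exists_isPath_of_mem_branch hg h hj hx'
  have := Walk.IsPath.eq_of_length_add_lt_egirth hg hpp.of_cons hqp.of_cons (by omega)
  subst this
  omega

theorem disjoint_branch_swap (hg : (g : ℕ∞) ≤ G.egirth) {i j : ℕ} {u v : V}
    (h : G.Adj u v) (hi : i + 1 < g) (hj : j + 1 < g) (hij : i + j + 1 < g) :
    Disjoint (G.branch i u v) (G.branch j v u) := by
  rw [Finset.disjoint_left]
  intro x hx hx'
  obtain ⟨p, hp, hpp⟩ := exists_isPath_of_mem_branch hg h hi hx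
  obtain ⟨q, hq, hqp⟩ := exists_isPath_of_mem_branch hg h.symm hj hx'
  have := Walk.IsPath.eq_of_length_add_lt_egirth hg hpp hqp.of_cons (by
    simp only [Walk.length_cons]; omega)
  rw [Walk.cons_isPath_iff, ← this] at hqp
  exact hqp.2 (by simp)

theorem notMem_branch (hg : (g : ℕ∞) ≤ G.egirth) {i : ℕ} {u v : V}
    (h : G.Adj u v) (hi : i + 1 < g) : u ∉ G.branch i u v := by
  intro hx
  obtain ⟨p, -, hpp⟩ := exists_isPath_of_mem_branch hg h hi hx
  rw [Walk.cons_isPath_iff] at hpp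
  exact hpp.2 p.end_mem_support

theorem card_branch (hg : (g : ℕ∞) ≤ G.egirth) :
    ∀ {i : ℕ} {u v : V}, G.Adj u v → 2 * i < g → (G.branch i u v).card = G.branchCount i u v
  | 0, _, _, _, _ => by simp [branch, branchCount]
  | i + 1, u, v, h, hi => by
    rw [branch, branchCount, Finset.card_biUnion]
    · refine Finset.sum_congr rfl fun w hw => ?_
      simp only [Finset.mem_erase, mem_neighborFinset] at hw
      exact card_branch hg hw.2 (by omega)
    · intro w hw w' hw' hne
      rw [Finset.mem_coe, Finset.mem_erase, mem_neighborFinset] at hw hw'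
      exact disjoint_branch_of_ne hg hw.2 hw'.2 hne (by omega)

theorem card_biUnion_branch (hg : (g : ℕ∞) ≤ G.egirth) {r : ℕ} (hr : 2 * r ≤ g) (hg3 : 3 ≤ g)
    {u v : V} (h : G.Adj u v) :
    ((Finset.range r).biUnion fun i => G.branch i u v).card =
      ∑ i ∈ Finset.range r, G.branchCount i u v := by
  rw [Finset.card_biUnion]
  · refine Finset.sum_congr rfl fun i hi => card_branch hg h ?_
    have := Finset.mem_range.1 hi
    omega
  · intro i hi j hj hne
    have := Finset.mem_range.1 hi
    have := Finset.mem_range.1 hj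
    exact disjoint_branch_of_length_ne hg h hne (by omega) (by omega) (by omega)

/-- The two trees growing from the ends of an edge are disjoint: this is the count for even girth.
The next lemma, rooted at a vertex, serves odd girth. -/
theorem sum_branchCount_add_le_card (hg : (g : ℕ∞) ≤ G.egirth) {r : ℕ} (hr : 2 * r ≤ g)
    (hg3 : 3 ≤ g) {u v : V} (h : G.Adj u v) :
    ∑ i ∈ Finset.range r, G.branchCount i u v + ∑ i ∈ Finset.range r, G.branchCount i v u ≤
      Fintype.card V := by
  rw [← card_biUnion_branch hg hr hg3 h, ← card_biUnion_branch hg hr hg3 h.symm,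
    ← Finset.card_union_of_disjoint]
  · exact Finset.card_le_univ _
  · simp only [Finset.disjoint_biUnion_left, Finset.disjoint_biUnion_right, Finset.mem_range]
    intro i hi j hj
    exact disjoint_branch_swap hg h (by omega) (by omega) (by omega)

theorem one_add_sum_branchCount_le_card (hg : (g : ℕ∞) ≤ G.egirth) {r : ℕ} (hr : 2 * r < g)
    (hg3 : 3 ≤ g) (u : V) :
    1 + ∑ v ∈ G.neighborFinset u, ∑ i ∈ Finset.range r, G.branchCount i u v ≤
      Fintype.card V := by
  have hcard : ((G.neighborFinset u).biUnion
      fun v => (Finset.range r).biUnion fun i => G.branch i u v).card =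
      ∑ v ∈ G.neighborFinset u, ∑ i ∈ Finset.range r, G.branchCount i u v := by
    rw [Finset.card_biUnion]
    · refine Finset.sum_congr rfl fun v hv => card_biUnion_branch hg hr.le hg3 ?_
      simpa using hv
    · intro v hv w hw hne
      simp only [Finset.disjoint_biUnion_left, Finset.disjoint_biUnion_right, Finset.mem_range]
      intro i hi j hj
      exact disjoint_branch_of_ne hg (by simpa using hv) (by simpa using hw) hne (by omega)
  rw [← hcard, add_comm, ← Finset.card_insert_of_notMem (a := u)]
  · exact Finset.card_le_univ _
  · simp only [Finset.mem_biUnion, not_exists, not_and, Finset.mem_range, mem_neighborFinset]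
    intro v hv i hi
    exact notMem_branch hg hv (by omega)

end Moore

end SimpleGraph

/-! ### Logarithmic inequalities -/

/-- The AM–GM inequality in logarithmic form, obtained by summing `log t ≤ t - 1` over the ratios
`t` of each value to the mean. -/
theorem Finset.card_mul_log_card_add_sum_log_le {ι : Type*} (s : Finset ι) (f : ι → ℝ)
    (hf : ∀ i ∈ s, 0 < f i) :
    s.card * Real.log s.card + ∑ i ∈ s, Real.log (f i) ≤ s.card * Real.log (∑ i ∈ s, f i) := by
  rcases s.eq_empty_or_nonempty with rfl | hs
  · simp
  have hm : (0 : ℝ) < s.card := by exact_mod_cast hs.card_pos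
  have hF : 0 < ∑ i ∈ s, f i := Finset.sum_pos hf hs
  have key : ∀ i ∈ s, Real.log (f i) + Real.log s.card - Real.log (∑ i ∈ s, f i) ≤
      f i * (s.card / ∑ i ∈ s, f i) - 1 := by
    intro i hi
    have h := Real.log_le_sub_one_of_pos (mul_pos (hf i hi) (div_pos hm hF))
    rwa [Real.log_mul (hf i hi).ne' (div_pos hm hF).ne', Real.log_div hm.ne' hF.ne',
      ← add_sub_assoc] at h
  have h := Finset.sum_le_sum key
  rw [Finset.sum_sub_distrib, Finset.sum_sub_distrib, Finset.sum_add_distrib, ← Finset.sum_mul,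
    mul_div_cancel₀ _ hF.ne'] at h
  simp only [Finset.sum_const, nsmul_eq_mul, mul_one] at h
  linarith

theorem Finset.sum_sum_erase {ι : Type*} [DecidableEq ι] (s : Finset ι) (f : ι → ℝ) :
    ∑ u ∈ s, ∑ w ∈ s.erase u, f w = ((s.card : ℝ) - 1) * ∑ w ∈ s, f w := by
  have h : ∀ u ∈ s, ∑ w ∈ s.erase u, f w = ∑ w ∈ s, f w - f u := fun u hu => by
    rw [Finset.sum_erase_eq_sub hu]
  rw [Finset.sum_congr rfl h, Finset.sum_sub_distrib, Finset.sum_const, nsmul_eq_mul]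
  ring

/-- The second derivative is `(x - 2) / (x - 1) ^ 2`, so 2 is the natural end point; this is why
minimum degree two is needed. -/
theorem convexOn_mul_log_sub_one : ConvexOn ℝ (Set.Ici 2) fun x : ℝ => x * Real.log (x - 1) := by
  have hd : ∀ x : ℝ, 2 ≤ x →
      HasDerivAt (fun x : ℝ => x * Real.log (x - 1)) (Real.log (x - 1) + x / (x - 1)) x := by
    intro x hx
    have h := (hasDerivAt_id x).mul (((hasDerivAt_id x).sub_const 1).log
      (show id x - 1 ≠ 0 by simp only [id]; linarith))
    convert! h using 1
    simp [div_eq_mul_inv]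
  refine MonotoneOn.convexOn_of_deriv (convex_Ici 2)
    (fun x hx => (hd x hx).continuousAt.continuousWithinAt)
    (fun x hx => (hd x (interior_subset hx)).differentiableAt.differentiableWithinAt) ?_
  rw [interior_Ici]
  intro x hx y hy hxy
  have hx : 2 < x := hx
  have hy : 2 < y := hy
  rw [(hd x hx.le).deriv, (hd y hy.le).deriv]
  have e : ∀ z : ℝ, 2 < z → z / (z - 1) = 1 + (z - 1)⁻¹ := fun z hz => by
    have : z - 1 ≠ 0 := by linarith
    field_simp
    ring
  rw [e x hx, e y hy]
  have hl := Real.log_le_sub_one_of_pos (show 0 < (x - 1) / (y - 1) from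
    div_pos (by linarith) (by linarith))
  rw [Real.log_div (by linarith) (by linarith)] at hl
  have h3 : (x - 1)⁻¹ - (y - 1)⁻¹ ≤ 1 - (x - 1) / (y - 1) := by
    have hx0 : x - 1 ≠ 0 := by linarith
    have hy0 : y - 1 ≠ 0 := by linarith
    have e1 : (x - 1)⁻¹ - (y - 1)⁻¹ = (y - x) / (y - 1) * (x - 1)⁻¹ := by
      field_simp; ring
    have e2 : 1 - (x - 1) / (y - 1) = (y - x) / (y - 1) := by
      field_simp; ring
    rw [e1, e2]
    exact mul_le_of_le_one_right (div_nonneg (by linarith) (by linarith))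
      (inv_le_one_of_one_le₀ (by linarith))
  linarith

/-! ### The Moore bound for irregular graphs -/

namespace SimpleGraph

variable {V : Type*} [Fintype V] (G : SimpleGraph V) [DecidableRel G.Adj]

theorem sum_sum_neighborFinset_comm (f : V → V → ℝ) :
    ∑ u, ∑ v ∈ G.neighborFinset u, f u v = ∑ v, ∑ u ∈ G.neighborFinset v, f u v :=
  Finset.sum_comm' (by simp [adj_comm])

variable {G}

theorem sum_degree_mul_log_le (hdeg : ∀ v, 2 ≤ G.degree v) [Nonempty V] :
    (∑ v, (G.degree v : ℝ)) * Real.log ((∑ v, (G.degree v : ℝ)) / Fintype.card V - 1) ≤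
      ∑ v, (G.degree v : ℝ) * Real.log (G.degree v - 1) := by
  have hn : (0 : ℝ) < Fintype.card V := by exact_mod_cast Fintype.card_pos
  have h := convexOn_mul_log_sub_one.map_sum_le (t := Finset.univ)
    (w := fun _ : V => (Fintype.card V : ℝ)⁻¹) (p := fun v => (G.degree v : ℝ))
    (fun _ _ => by positivity) (by simp [hn.ne'])
    (fun v _ => by simpa using (by exact_mod_cast hdeg v : (2 : ℝ) ≤ G.degree v))
  simp only [smul_eq_mul, ← Finset.mul_sum] at h
  have h2 := mul_le_mul_of_nonneg_left h hn.le
  rw [← mul_assoc, ← mul_assoc, ← mul_assoc, mul_inv_cancel₀ hn.ne', one_mul, one_mul] at h2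
  rwa [div_eq_inv_mul]

variable [DecidableEq V]

theorem one_le_branchCount (hdeg : ∀ v, 2 ≤ G.degree v) :
    ∀ (i : ℕ) (u v : V), 1 ≤ G.branchCount i u v
  | 0, _, _ => le_rfl
  | i + 1, u, v => by
    rw [branchCount]
    have hne : ((G.neighborFinset v).erase u).Nonempty := by
      rw [← Finset.card_pos]
      have := Finset.pred_card_le_card_erase (s := G.neighborFinset v) (a := u)
      have := hdeg v
      rw [← card_neighborFinset_eq_degree] at this
      omega
    obtain ⟨w, hw⟩ := hne
    exact (one_le_branchCount hdeg i v w).trans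
      (Finset.single_le_sum (f := fun w => G.branchCount i v w) (fun _ _ => Nat.zero_le _) hw)

/-- Induction on the length, with AM–GM over the `deg v - 1` continuations of each dart `(u, v)`.
Summed over `u`, each continuation `w` is omitted exactly once, so its logarithm occurs `deg v - 1`
times and this factor cancels. -/
theorem mul_sum_degree_mul_log_le_sum_log_branchCount (hdeg : ∀ v, 2 ≤ G.degree v) (i : ℕ) :
    i * ∑ v, (G.degree v : ℝ) * Real.log (G.degree v - 1) ≤
      ∑ u, ∑ v ∈ G.neighborFinset u, Real.log (G.branchCount i u v) := by
  induction i with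
  | zero => simp [branchCount]
  | succ i ih =>
    -- Darts are grouped by their head `v`, where the walk continues.
    rw [G.sum_sum_neighborFinset_comm]
    have hstep : ∀ v, (G.degree v : ℝ) * Real.log (G.degree v - 1) +
        ∑ w ∈ G.neighborFinset v, Real.log (G.branchCount i v w) ≤
        ∑ u ∈ G.neighborFinset v, Real.log (G.branchCount (i + 1) u v) := by
      intro v
      have hd : (2 : ℝ) ≤ G.degree v := by exact_mod_cast hdeg v
      have hd1 : (0 : ℝ) < G.degree v - 1 := by linarith
      have hu : ∀ u ∈ G.neighborFinset v, ((G.degree v : ℝ) - 1) * Real.log (G.degree v - 1) +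
          ∑ w ∈ (G.neighborFinset v).erase u, Real.log (G.branchCount i v w) ≤
          ((G.degree v : ℝ) - 1) * Real.log (G.branchCount (i + 1) u v) := by
        intro u hu
        have hc : (((G.neighborFinset v).erase u).card : ℝ) = G.degree v - 1 := by
          rw [Finset.card_erase_of_mem hu, card_neighborFinset_eq_degree, Nat.cast_sub]
          · simp
          · have := hdeg v; omega
        have h := Finset.card_mul_log_card_add_sum_log_le ((G.neighborFinset v).erase u)
          (fun w => (G.branchCount i v w : ℝ))
          (fun w _ => by exact_mod_cast one_le_branchCount hdeg i v w)
        rw [hc] at h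
        rwa [branchCount, Nat.cast_sum]
      have h := Finset.sum_le_sum hu
      rw [Finset.sum_add_distrib, Finset.sum_sum_erase, ← Finset.mul_sum, Finset.sum_const,
        nsmul_eq_mul, card_neighborFinset_eq_degree, ← mul_add,
        ← Finset.mul_sum] at h
      exact le_of_mul_le_mul_left h hd1
    have h := Finset.sum_le_sum fun v (_ : v ∈ Finset.univ) => hstep v
    rw [Finset.sum_add_distrib] at h
    push_cast
    linarith

/-- AM–GM over all darts turns the bound on the sum of logarithms into one on the sum; Jensen then
replaces the degrees by their average. -/
theorem sum_degree_mul_pow_le_sum_branchCount (hdeg : ∀ v, 2 ≤ G.degree v) [Nonempty V] (i : ℕ) :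
    (∑ v, (G.degree v : ℝ)) * ((∑ v, (G.degree v : ℝ)) / Fintype.card V - 1) ^ i ≤
      ∑ u, ∑ v ∈ G.neighborFinset u, (G.branchCount i u v : ℝ) := by
  set M : ℝ := ∑ v, (G.degree v : ℝ) with hM
  have hn : (0 : ℝ) < Fintype.card V := by exact_mod_cast Fintype.card_pos
  have hM2 : 2 * (Fintype.card V : ℝ) ≤ M := by
    have := Finset.sum_le_sum fun v (_ : v ∈ Finset.univ) =>
      (by exact_mod_cast hdeg v : (2 : ℝ) ≤ G.degree v)
    simp only [Finset.sum_const, Finset.card_univ, nsmul_eq_mul] at this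
    linarith
  have hM0 : 0 < M := by linarith
  have ha : 0 < M / Fintype.card V - 1 := by
    have : 2 ≤ M / Fintype.card V := by rwa [le_div_iff₀ hn]
    linarith
  have h1 := sum_degree_mul_log_le hdeg
  have h2 := mul_sum_degree_mul_log_le_sum_log_branchCount hdeg i
  have h3 := Finset.card_mul_log_card_add_sum_log_le
    (Finset.univ.sigma fun u : V => G.neighborFinset u) (fun e => (G.branchCount i e.1 e.2 : ℝ))
    (fun e _ => by exact_mod_cast one_le_branchCount hdeg i e.1 e.2)
  rw [Finset.sum_sigma, Finset.sum_sigma, Finset.card_sigma] at h3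
  simp only [card_neighborFinset_eq_degree, Nat.cast_sum] at h3
  rw [← hM] at h1 h3
  set N : ℝ := ∑ u, ∑ v ∈ G.neighborFinset u, (G.branchCount i u v : ℝ) with hN
  have hN0 : 0 < N := by
    refine Finset.sum_pos (fun u _ => Finset.sum_pos (fun v _ => ?_) ?_) Finset.univ_nonempty
    · exact_mod_cast one_le_branchCount hdeg i u v
    · rw [← Finset.card_pos, card_neighborFinset_eq_degree]
      have := hdeg u
      omega
  rw [← Real.log_le_log_iff (by positivity) hN0, Real.log_mul hM0.ne' (by positivity),
    Real.log_pow]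
  have h4 := mul_le_mul_of_nonneg_left h1 (Nat.cast_nonneg (α := ℝ) i)
  refine le_of_mul_le_mul_left ?_ hM0
  linarith

/-- The Moore bound for irregular graphs of Alon, Hoory and Linial. -/
theorem mooreBound_averageDegree_le_card (hdeg : ∀ v, 2 ≤ G.degree v) [Nonempty V] {g : ℕ}
    (hg3 : 3 ≤ g) (hg : (g : ℕ∞) ≤ G.egirth) :
    mooreBound ((∑ v, (G.degree v : ℝ)) / Fintype.card V) g ≤ Fintype.card V := by
  set M : ℝ := ∑ v, (G.degree v : ℝ) with hM
  have hn : (0 : ℝ) < Fintype.card V := by exact_mod_cast Fintype.card_pos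
  have hM0 : 0 < M := Finset.sum_pos (fun v _ => by
    have := hdeg v
    exact_mod_cast (by omega : 0 < G.degree v)) Finset.univ_nonempty
  set a : ℝ := M / Fintype.card V with ha
  have hMa : M = a * Fintype.card V := by rw [ha]; field_simp
  have hcount : M * ∑ i ∈ Finset.range (g / 2), (a - 1) ^ i ≤
      ∑ u, ∑ v ∈ G.neighborFinset u,
        ∑ i ∈ Finset.range (g / 2), (G.branchCount i u v : ℝ) := by
    have hcomm : ∑ u, ∑ v ∈ G.neighborFinset u,
        ∑ i ∈ Finset.range (g / 2), (G.branchCount i u v : ℝ) =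
        ∑ i ∈ Finset.range (g / 2), ∑ u, ∑ v ∈ G.neighborFinset u,
          (G.branchCount i u v : ℝ) := by
      rw [Finset.sum_comm]
      exact Finset.sum_congr rfl fun u _ => Finset.sum_comm
    rw [hcomm, Finset.mul_sum]
    exact Finset.sum_le_sum fun i _ => sum_degree_mul_pow_le_sum_branchCount hdeg i
  unfold mooreBound
  split_ifs with hodd
  -- Odd girth: average the vertex-rooted count over all vertices.
  · have h : ∀ u ∈ Finset.univ, 1 + ∑ v ∈ G.neighborFinset u,
        ∑ i ∈ Finset.range (g / 2), (G.branchCount i u v : ℝ) ≤ Fintype.card V := fun u _ => by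
      have := one_add_sum_branchCount_le_card hg (r := g / 2)
        (by obtain ⟨k, rfl⟩ := hodd; omega) hg3 u
      exact_mod_cast this
    have h2 := Finset.sum_le_sum h
    rw [Finset.sum_add_distrib] at h2
    simp only [Finset.sum_const, Finset.card_univ, nsmul_eq_mul, mul_one] at h2
    refine le_of_mul_le_mul_left ?_ hn
    rw [mul_add, mul_one, ← mul_assoc, mul_comm _ a, ← hMa]
    linarith
  · have h : ∀ u ∈ Finset.univ, ∑ v ∈ G.neighborFinset u,
        (∑ i ∈ Finset.range (g / 2), (G.branchCount i u v : ℝ) +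
          ∑ i ∈ Finset.range (g / 2), (G.branchCount i v u : ℝ)) ≤
        ∑ v ∈ G.neighborFinset u, (Fintype.card V : ℝ) := fun u _ =>
      Finset.sum_le_sum fun v hv => by
        have := sum_branchCount_add_le_card hg (r := g / 2) (by omega) hg3
          (u := u) (v := v) (by simpa using hv)
        exact_mod_cast this
    have h2 := Finset.sum_le_sum h
    simp only [Finset.sum_add_distrib] at h2
    -- Even girth: the edge-rooted count is averaged over darts. Reversing darts shows that both
    -- halves contribute equally, whence the factor 2.
    rw [G.sum_sum_neighborFinset_comm
      (fun u v => ∑ i ∈ Finset.range (g / 2), (G.branchCount i v u : ℝ))] at h2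
    simp only [Finset.sum_const, nsmul_eq_mul, card_neighborFinset_eq_degree,
      ← Finset.sum_mul] at h2
    rw [← hM] at h2
    refine le_of_mul_le_mul_left ?_ hM0
    linarith

end SimpleGraph

/-! ### The spectral bound on the boundary -/

namespace SimpleGraph

open Matrix

variable {V : Type*} [Fintype V] [DecidableEq V] {G : SimpleGraph V} [DecidableRel G.Adj]

/-- The all-ones vector has eigenvalue `d`, and all eigenvalues but the first are below `d`. Hence
it is orthogonal to every basis eigenvector except the first, so `f` is orthogonal to that one and
only eigenvalues at most `λ` contribute. -/
theorem IsRegularOfDegree.dotProduct_adjMatrix_mulVec_le {d : ℕ} (hreg : G.IsRegularOfDegree d)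
    (hlam : G.secondLargestEigenvalue < d) {f : V → ℝ} (hf : ∑ v, f v = 0) :
    f ⬝ᵥ G.adjMatrix ℝ *ᵥ f ≤ G.secondLargestEigenvalue * (f ⬝ᵥ f) := by
  by_cases hcard : 1 < Fintype.card V
  swap
  · have hf0 : f = 0 := by
      have := Fintype.card_le_one_iff_subsingleton.1 (not_lt.1 hcard)
      funext v
      rwa [Fintype.sum_subsingleton f v] at hf
    simp [hf0]
  have hlam' : G.secondLargestEigenvalue =
      (G.isHermitian_adjMatrix ℝ).eigenvalues₀ ⟨1, hcard⟩ := by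
    rw [secondLargestEigenvalue, dif_pos hcard]
  have hT := isSymmetric_toEuclideanLin_iff.mpr (G.isHermitian_adjMatrix ℝ)
  set T := toEuclideanLin (G.adjMatrix ℝ) with hTdef
  set b := hT.eigenvectorBasis finrank_euclideanSpace with hb
  set μ := (G.isHermitian_adjMatrix ℝ).eigenvalues₀ with hμ
  have hbT : ∀ i, T (b i) = μ i • b i := fun i =>
    hT.apply_eigenvectorBasis finrank_euclideanSpace i
  have hin : ∀ i x, inner ℝ (b i) (T x) = μ i * inner ℝ (b i) x := fun i x => by
    rw [← hT (b i) x, hbT, real_inner_smul_left]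
  let z : Fin (Fintype.card V) := ⟨0, by omega⟩
  have hle : ∀ i, i ≠ z → μ i ≤ G.secondLargestEigenvalue := by
    intro i hi
    rw [hlam']
    apply (G.isHermitian_adjMatrix ℝ).eigenvalues₀_antitone
    rw [Fin.le_def]
    have : i.1 ≠ 0 := fun h => hi (Fin.ext h)
    simp only
    omega
  let e : EuclideanSpace ℝ V := WithLp.toLp 2 fun _ => 1
  let F : EuclideanSpace ℝ V := WithLp.toLp 2 f
  have he : T e = (d : ℝ) • e := by
    ext v
    simp [T, e, hreg v]
  have hei : ∀ i, i ≠ z → inner ℝ (b i) e = 0 := by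
    intro i hi
    have h := hin i e
    rw [he, real_inner_smul_right] at h
    have h2 : ((d : ℝ) - μ i) * inner ℝ (b i) e = 0 := by linarith
    rcases mul_eq_zero.1 h2 with h3 | h3
    · have := hle i hi
      linarith
    · exact h3
  have hFe : inner ℝ F e = 0 := by
    simpa [F, e, PiLp.inner_apply] using hf
  have hez : inner ℝ (b z) e ≠ 0 := by
    intro h0
    have h := b.sum_inner_mul_inner e e
    rw [Finset.sum_eq_zero] at h
    · have h1 := inner_self_eq_zero.1 h.symm
      have h2 := congrFun (congrArg WithLp.ofLp h1)
      have : Nonempty V := Fintype.card_pos_iff.1 (by omega)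
      simpa [e] using h2 (Classical.arbitrary V)
    · intro i _
      by_cases hi : i = z
      · rw [hi, h0, mul_zero]
      · rw [hei i hi, mul_zero]
  have hFz : inner ℝ (b z) F = 0 := by
    have h := b.sum_inner_mul_inner F e
    rw [Finset.sum_eq_single z (fun i _ hi => by rw [hei i hi, mul_zero]) (by simp), hFe] at h
    rw [real_inner_comm]
    exact (mul_eq_zero.1 h).resolve_right hez
  have h1 : f ⬝ᵥ G.adjMatrix ℝ *ᵥ f = inner ℝ F (T F) := by
    simp [F, T, PiLp.inner_apply, dotProduct, mul_comm]
  have h2 : f ⬝ᵥ f = inner ℝ F F := by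
    rw [PiLp.inner_apply]
    simp [F, dotProduct, sq]
  rw [h1, h2, ← b.sum_inner_mul_inner F (T F), ← b.sum_inner_mul_inner F F, Finset.mul_sum]
  refine Finset.sum_le_sum fun i _ => ?_
  rw [hin, real_inner_comm (b i) F]
  by_cases hi : i = z
  · rw [hi, hFz]
    simp
  · nlinarith [mul_self_nonneg (inner ℝ (b i) F), hle i hi]

variable (G) in
/-- The number of edges of `G` leaving `X`. -/
def boundarySize (X : Finset V) : ℕ :=
  ∑ x ∈ X, (G.neighborFinset x \ X).card

theorem boundarySize_add_sum_card_inter (X : Finset V) :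
    G.boundarySize X + ∑ x ∈ X, (G.neighborFinset x ∩ X).card = ∑ x ∈ X, G.degree x := by
  rw [boundarySize, ← Finset.sum_add_distrib]
  refine Finset.sum_congr rfl fun x _ => ?_
  rw [Finset.card_sdiff_add_card_inter, card_neighborFinset_eq_degree]

theorem boundarySize_compl (X : Finset V) : G.boundarySize Xᶜ = G.boundarySize X := by
  have h : ∀ Y : Finset V, G.boundarySize Y = ∑ x ∈ Y, ∑ y ∈ Yᶜ, if G.Adj x y then 1 else 0 := by
    intro Y
    refine Finset.sum_congr rfl fun x _ => ?_
    rw [← Finset.card_filter]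
    congr 1
    ext y
    simp [and_comm]
  rw [h, h, compl_compl, Finset.sum_comm]
  simp only [adj_comm]

/-- The quadratic form bound is applied to `n χ - k 1`, the indicator of `X` scaled and shifted to
have sum zero. -/
theorem IsRegularOfDegree.mul_card_mul_card_le_boundarySize {d : ℕ}
    (hreg : G.IsRegularOfDegree d) (hlam : G.secondLargestEigenvalue < d) (X : Finset V) :
    (d - G.secondLargestEigenvalue) * X.card * (Fintype.card V - X.card) ≤
      Fintype.card V * G.boundarySize X := by
  rcases isEmpty_or_nonempty V with hV | hV
  · simp [Finset.eq_empty_of_isEmpty X]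
  have hn : (0 : ℝ) < Fintype.card V := by exact_mod_cast Fintype.card_pos
  set n : ℝ := (Fintype.card V : ℝ) with hnd
  set k : ℝ := (X.card : ℝ) with hk
  let χ : V → ℝ := fun v => if v ∈ X then 1 else 0
  let o : V → ℝ := fun _ => 1
  have hfo : (n • χ - k • o) = fun v => n * χ v - k := by funext v; simp [o]
  have hχo : χ ⬝ᵥ o = k := by simp [dotProduct, χ, o, hk]
  have hχχ : χ ⬝ᵥ χ = k := by simp [dotProduct, χ, hk]
  have hoo : o ⬝ᵥ o = n := by simp [dotProduct, o, hnd]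
  have hAo : G.adjMatrix ℝ *ᵥ o = (d : ℝ) • o := by
    funext v
    simp [o, hreg v]
  have hχA : χ ⬝ᵥ G.adjMatrix ℝ *ᵥ χ = d * k - G.boundarySize X := by
    have h := boundarySize_add_sum_card_inter (G := G) X
    rw [Finset.sum_congr rfl fun x _ => hreg x, Finset.sum_const, smul_eq_mul] at h
    have h2 : χ ⬝ᵥ G.adjMatrix ℝ *ᵥ χ = ∑ x ∈ X, ((G.neighborFinset x ∩ X).card : ℝ) := by
      simp [dotProduct, χ]
    rw [h2, hk, ← Nat.cast_sum]
    have h3 : ((G.boundarySize X + ∑ x ∈ X, (G.neighborFinset x ∩ X).card : ℕ) : ℝ) =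
      (X.card * d : ℕ) := by rw [h]
    push_cast at h3 ⊢
    linarith
  have hoA : o ⬝ᵥ G.adjMatrix ℝ *ᵥ χ = d * k := by
    rw [dotProduct_mulVec, ← mulVec_transpose, transpose_adjMatrix, hAo, smul_dotProduct,
      dotProduct_comm, hχo, smul_eq_mul]
  have hsum : ∑ v, (n • χ - k • o) v = 0 := by
    have : ∑ v, (n • χ - k • o) v = (n • χ - k • o) ⬝ᵥ o := by simp [dotProduct, o]
    rw [this, sub_dotProduct, smul_dotProduct, smul_dotProduct, hχo, hoo, smul_eq_mul, smul_eq_mul]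
    ring
  have h := hreg.dotProduct_adjMatrix_mulVec_le hlam hsum
  simp only [mulVec_sub, mulVec_smul, sub_dotProduct, dotProduct_sub, smul_dotProduct,
    dotProduct_smul, hAo, hχA, hoA, hχo, hχχ, hoo, dotProduct_comm o χ, smul_eq_mul] at h
  refine le_of_mul_le_mul_left ?_ hn
  linarith

end SimpleGraph

/-! ### Estimates of the Moore function -/

theorem mooreBound_le_mooreBound {x y : ℝ} (hx : 1 ≤ x) (hxy : x ≤ y) (g : ℕ) :
    mooreBound x g ≤ mooreBound y g := by
  have hs : ∑ i ∈ Finset.range (g / 2), (x - 1) ^ i ≤ ∑ i ∈ Finset.range (g / 2), (y - 1) ^ i :=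
    Finset.sum_le_sum fun i _ => pow_le_pow_left₀ (by linarith) (by linarith) i
  have h0 : 0 ≤ ∑ i ∈ Finset.range (g / 2), (x - 1) ^ i :=
    Finset.sum_nonneg fun i _ => pow_nonneg (by linarith) i
  unfold mooreBound
  split_ifs
  · have := mul_le_mul hxy hs h0 (by linarith)
    linarith
  · linarith

theorem add_mul_le_sum_one_add_pow {y : ℝ} (hy : 0 ≤ y) (r : ℕ) :
    r + r * (r - 1) / 2 * y ≤ ∑ i ∈ Finset.range r, (1 + y) ^ i := by
  induction r with
  | zero => simp
  | succ r ih =>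
    rw [Finset.sum_range_succ]
    have := one_add_mul_le_pow (show -2 ≤ y by linarith) r
    push_cast
    linarith

/-- The tangent at `2` bounds the Moore function from below. -/
theorem add_mul_le_mooreBound {y : ℝ} (hy : 0 ≤ y) (g : ℕ) :
    g + ((g / 2 : ℕ) - 1 : ℝ) / 2 * g * y ≤ mooreBound (2 + y) g := by
  have hs := add_mul_le_sum_one_add_pow hy (g / 2)
  have e : 2 + y - 1 = 1 + y := by ring
  unfold mooreBound
  rw [e]
  set r := g / 2 with hr
  split_ifs with h
  · have hg : g = 2 * r + 1 := by obtain ⟨k, rfl⟩ := h; omega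
    have hgr : (g : ℝ) = 2 * r + 1 := by exact_mod_cast hg
    have h1 := mul_le_mul_of_nonneg_left hs (show 0 ≤ 2 + y by linarith)
    have hr0 : (0 : ℝ) ≤ r := Nat.cast_nonneg r
    have hrr : (0 : ℝ) ≤ r * (r - 1) := by
      rcases Nat.eq_zero_or_pos r with h0 | h0
      · simp [h0]
      · exact mul_nonneg hr0 (by have : (1 : ℝ) ≤ r := by exact_mod_cast h0
                                 linarith)
    rw [hgr]
    nlinarith [mul_nonneg hrr (mul_nonneg hy hy), mul_nonneg hr0 hy]
  · have hg : g = 2 * r := by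
      rw [Nat.not_odd_iff_even] at h
      obtain ⟨k, rfl⟩ := h
      omega
    have hgr : (g : ℝ) = 2 * r := by exact_mod_cast hg
    rw [hgr]
    linarith

/-- Here `k`, `a`, `c` stand for the order, average inner degree and boundary of the peeled set. -/
theorem sub_two_mul_le_of_mooreBound_le {d lam a k c : ℝ} {g : ℕ} (hd : 5 ≤ d) (hg : 4 ≤ g)
    (hlam : lam < d)
    (hspec : 2 * (d - 2) * g / (d - lam) ≤ mooreBound (d - 2 / (((g / 2 : ℕ) : ℝ) - 1)) g)
    (hk : 0 < k) (ha : 2 ≤ a) (hc : k * (d - a) = c) (hmoore : mooreBound a g ≤ k)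
    (hcut : (d - lam) * k ≤ 2 * c) : (d - 2) * g ≤ c := by
  have hr : 2 ≤ g / 2 := by omega
  have hr' : (1 : ℝ) ≤ ((g / 2 : ℕ) : ℝ) - 1 := by
    have : (2 : ℝ) ≤ ((g / 2 : ℕ) : ℝ) := by exact_mod_cast hr
    linarith
  have hdl : 0 < d - lam := by linarith
  have hg0 : (0 : ℝ) ≤ g := Nat.cast_nonneg g
  rcases le_or_gt (2 / (((g / 2 : ℕ) : ℝ) - 1)) (d - a) with hz | hz
  -- Sparse case: `(r - 1)(d - a) / 2 ≥ 1`, so `d - a` times the tangent bound is at least `g (d -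
  -- a) + g (a - 2)`.
  · rw [div_le_iff₀ (by linarith)] at hz
    have hz0 : 0 ≤ d - a := by nlinarith
    have h1 := add_mul_le_mooreBound (show 0 ≤ a - 2 by linarith) g
    rw [add_sub_cancel] at h1
    have h2 := mul_le_mul_of_nonneg_left (h1.trans hmoore) hz0
    have h3 := mul_le_mul_of_nonneg_right hz (mul_nonneg hg0 (show 0 ≤ a - 2 by linarith))
    nlinarith
  -- Dense case: monotonicity of the Moore function and `hspec` bound `k` below, and `hcut` converts
  -- this to `c`.
  · have h2 : 2 / (((g / 2 : ℕ) : ℝ) - 1) ≤ 2 := div_le_self (by norm_num) hr'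
    have h1 := mooreBound_le_mooreBound (show 1 ≤ d - 2 / (((g / 2 : ℕ) : ℝ) - 1) by linarith)
      (show d - 2 / (((g / 2 : ℕ) : ℝ) - 1) ≤ a by linarith) g
    have h3 := hspec.trans (h1.trans hmoore)
    rw [div_le_iff₀ hdl] at h3
    linarith

/-! ### Peeling to minimum degree two -/

namespace SimpleGraph

variable {V : Type*} [Fintype V] [DecidableEq V] {G : SimpleGraph V} [DecidableRel G.Adj]

theorem boundarySize_erase_le {Y : Finset V} {v : V} (hv : v ∈ Y)
    (h : (G.neighborFinset v ∩ Y).card ≤ (G.neighborFinset v \ Y).card) :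
    G.boundarySize (Y.erase v) ≤ G.boundarySize Y := by
  have h1 : ∀ x ∈ Y.erase v, (G.neighborFinset x \ Y.erase v).card ≤
      (G.neighborFinset x \ Y).card + if x ∈ G.neighborFinset v then 1 else 0 := by
    intro x hx
    split_ifs with hxv
    · refine (Finset.card_le_card (t := insert v (G.neighborFinset x \ Y)) ?_).trans
        (Finset.card_insert_le _ _)
      intro y
      simp only [Finset.mem_sdiff, Finset.mem_erase, Finset.mem_insert]
      tauto
    · refine Finset.card_le_card ?_
      intro y
      simp only [Finset.mem_sdiff, Finset.mem_erase, mem_neighborFinset] at hxv ⊢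
      rintro ⟨hxy, hy⟩
      refine ⟨hxy, fun hyY => hy ⟨?_, hyY⟩⟩
      rintro rfl
      exact hxv hxy.symm
  have h2 := Finset.sum_le_sum h1
  rw [Finset.sum_add_distrib, ← Finset.card_filter] at h2
  have h3 : ((Y.erase v).filter (· ∈ G.neighborFinset v)).card ≤
      (G.neighborFinset v ∩ Y).card := by
    refine Finset.card_le_card ?_
    intro x
    simp only [Finset.mem_filter, Finset.mem_erase, Finset.mem_inter]
    tauto
  have h4 := Finset.add_sum_erase Y (fun x => (G.neighborFinset x \ Y).card) hv
  unfold boundarySize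
  omega

/-- A smallest admissible set works: a vertex with at most one neighbour inside lies off `F` and has
at least one neighbour outside, so it could be erased without enlarging the boundary. -/
theorem exists_subset_boundarySize_le {F X : Finset V} (hFX : F ⊆ X)
    (hF : ∀ x ∈ F, 2 ≤ (G.neighborFinset x ∩ F).card) (hdeg : ∀ x, 2 ≤ G.degree x) :
    ∃ Y, F ⊆ Y ∧ Y ⊆ X ∧ G.boundarySize Y ≤ G.boundarySize X ∧
      ∀ x ∈ Y, 2 ≤ (G.neighborFinset x ∩ Y).card := by
  obtain ⟨Y, hY, hmin⟩ := Finset.exists_min_image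
    (X.powerset.filter fun Y => F ⊆ Y ∧ G.boundarySize Y ≤ G.boundarySize X) Finset.card
    ⟨X, by simp [hFX]⟩
  simp only [Finset.mem_filter, Finset.mem_powerset] at hY hmin
  refine ⟨Y, hY.2.1, hY.1, hY.2.2, fun v hv => ?_⟩
  by_contra! hlt
  have hvF : v ∉ F := fun hvF =>
    absurd ((hF v hvF).trans (Finset.card_le_card (Finset.inter_subset_inter_left hY.2.1)))
      (by omega)
  have hd := hdeg v
  rw [← card_neighborFinset_eq_degree, ← Finset.card_sdiff_add_card_inter _ Y] at hd
  have := hmin (Y.erase v) ⟨(Finset.erase_subset _ _).trans hY.1,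
    Finset.subset_erase.2 ⟨hY.2.1, hvF⟩, (boundarySize_erase_le hv (by omega)).trans hY.2.2⟩
  have := Finset.card_erase_lt_of_mem hv
  omega

omit [Fintype V] [DecidableEq V] [DecidableRel G.Adj] in
theorem egirth_le_egirth_comap {W : Type*} (f : W ↪ V) : G.egirth ≤ (G.comap f).egirth :=
  IsContained.egirth_le ⟨(Embedding.comap f G).toCopy⟩

theorem degree_comap_subtype (Y : Finset V) (x : {x // x ∈ Y})
    [DecidableRel (G.comap (Function.Embedding.subtype (· ∈ Y))).Adj] :
    (G.comap (Function.Embedding.subtype (· ∈ Y))).degree x = (G.neighborFinset x ∩ Y).card := by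
  rw [← card_neighborFinset_eq_degree, ← Finset.card_map (Function.Embedding.subtype (· ∈ Y))]
  congr 1
  ext y
  simp only [Finset.mem_map, mem_neighborFinset, comap_adj, Finset.mem_inter]
  exact ⟨fun ⟨z, hz, hzy⟩ => hzy ▸ ⟨hz, z.2⟩, fun ⟨h, hy⟩ => ⟨⟨y, hy⟩, h, rfl⟩⟩

theorem IsRegularOfDegree.sub_two_mul_le_boundarySize {d g : ℕ} (hd : 5 ≤ d)
    (hreg : G.IsRegularOfDegree d) (hgirth : (g : ℕ∞) ≤ G.egirth) (hg : 4 ≤ g)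
    (hlam : G.secondLargestEigenvalue < d)
    (hspec : 2 * ((d : ℝ) - 2) * g / (d - G.secondLargestEigenvalue) ≤
      mooreBound ((d : ℝ) - 2 / (((g / 2 : ℕ) : ℝ) - 1)) g)
    {F X : Finset V} (hFX : F ⊆ X) (hF0 : F.Nonempty)
    (hF : ∀ x ∈ F, 2 ≤ (G.neighborFinset x ∩ F).card) (hX : 2 * X.card ≤ Fintype.card V) :
    (d - 2) * g ≤ G.boundarySize X := by
  obtain ⟨Y, hFY, hYX, hle, hY⟩ := exists_subset_boundarySize_le hFX hF
    (fun x => by rw [hreg x]; omega)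
  refine le_trans ?_ hle
  have hY0 : Y.Nonempty := hF0.mono hFY
  have : Nonempty {x // x ∈ Y} := hY0.to_subtype
  classical
  have hk : (0 : ℝ) < Y.card := by exact_mod_cast hY0.card_pos
  have hn : (2 * Y.card : ℝ) ≤ Fintype.card V := by
    have := Finset.card_le_card hYX
    exact_mod_cast (by omega : 2 * Y.card ≤ Fintype.card V)
  have hdegY : ∀ x, 2 ≤ (G.comap (Function.Embedding.subtype (· ∈ Y))).degree x := fun x => by
    rw [degree_comap_subtype Y x]
    exact hY x x.2
  have hmoore := mooreBound_averageDegree_le_card hdegY (by omega)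
    (hgirth.trans (egirth_le_egirth_comap _))
  have hcardY : Fintype.card {x // x ∈ Y} = Y.card := Fintype.card_coe Y
  have hsumY : ∑ x : {x // x ∈ Y}, ((G.comap (Function.Embedding.subtype (· ∈ Y))).degree x : ℝ) =
      d * Y.card - G.boundarySize Y := by
    have h := boundarySize_add_sum_card_inter (G := G) Y
    rw [Finset.sum_congr rfl fun x _ => hreg x, Finset.sum_const, smul_eq_mul] at h
    simp only [degree_comap_subtype]
    rw [Finset.sum_coe_sort Y fun x => ((G.neighborFinset x ∩ Y).card : ℝ), ← Nat.cast_sum,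
      eq_sub_iff_add_eq, add_comm]
    exact_mod_cast h.trans (mul_comm _ _)
  have h2 : (2 : ℝ) * Y.card ≤ d * Y.card - G.boundarySize Y := by
    rw [← hsumY]
    have := Finset.sum_le_sum fun x (_ : x ∈ Finset.univ) =>
      (by exact_mod_cast hdegY x : (2 : ℝ) ≤ (G.comap (Function.Embedding.subtype (· ∈ Y))).degree x)
    rw [Finset.sum_const, Finset.card_univ, nsmul_eq_mul] at this
    rw [hcardY] at this
    linarith
  have hm : mooreBound ((d * Y.card - G.boundarySize Y) / Y.card : ℝ) g ≤ Y.card := by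
    rw [← hsumY, ← hcardY]
    exact hmoore
  have hcut := hreg.mul_card_mul_card_le_boundarySize hlam Y
  have hdl : (0 : ℝ) < d - G.secondLargestEigenvalue := by linarith
  -- The complement of `Y` has at least half of the vertices; this gives the factor 2.
  have hcut2 : (d - G.secondLargestEigenvalue) * Y.card ≤ 2 * G.boundarySize Y := by
    have hn0 : (0 : ℝ) < Fintype.card V := by linarith
    refine le_of_mul_le_mul_left ?_ hn0
    have := mul_le_mul_of_nonneg_left hn (mul_pos hdl hk).le
    linarith
  have := sub_two_mul_le_of_mooreBound_le (by exact_mod_cast hd) hg hlam hspec hk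
    ((le_div_iff₀ hk).2 h2) (by field_simp; ring) hm hcut2
  have e : (((d - 2) * g : ℕ) : ℝ) = (d - 2) * g := by
    rw [Nat.cast_mul, Nat.cast_sub (by omega)]
    norm_num
  rw [← e] at this
  exact_mod_cast this

end SimpleGraph

/-! ### Cycles in components and shortest cycles -/

namespace SimpleGraph

/-- An acyclic component would be a finite nontrivial tree, which has a leaf. -/
theorem ConnectedComponent.exists_isCycle {V : Type*} [Finite V] {H : SimpleGraph V}
    (hH : ∀ v, ∃ a b, a ≠ b ∧ H.Adj v a ∧ H.Adj v b) (c : H.ConnectedComponent) :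
    ∃ v ∈ c, ∃ w : H.Walk v v, w.IsCycle := by
  classical
  have := Fintype.ofFinite V
  by_contra! hc
  have hac : c.toSimpleGraph.IsAcyclic := fun v w hw =>
    hc v v.2 (w.map c.toSimpleGraph_hom) (hw.map Subtype.val_injective)
  have htree : c.toSimpleGraph.IsTree := ⟨c.connected_toSimpleGraph, hac⟩
  have hmem : ∀ {v a}, v ∈ c → H.Adj v a → a ∈ c := fun hv h =>
    (ConnectedComponent.mem_supp_congr_adj c h).1 hv
  obtain ⟨v, hv⟩ := c.nonempty_supp
  obtain ⟨a, -, -, ha, -⟩ := hH v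
  have : Nontrivial c := ⟨⟨v, hv⟩, ⟨a, hmem hv ha⟩, fun h => ha.ne (congrArg Subtype.val h)⟩
  obtain ⟨x, hx⟩ := htree.exists_vert_degree_one_of_nontrivial
  obtain ⟨y, -, hy⟩ := degree_eq_one_iff_existsUnique_adj.1 hx
  obtain ⟨p, q, hpq, hp, hq⟩ := hH x
  have hp' := hy ⟨p, hmem x.2 hp⟩ hp
  have hq' := hy ⟨q, hmem x.2 hq⟩ hq
  exact hpq (congrArg Subtype.val (hp'.trans hq'.symm))

theorem Walk.IsCycle.card_support_toFinset {V : Type*} [DecidableEq V] {G : SimpleGraph V} {v : V}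
    {C : G.Walk v v} (hC : C.IsCycle) : C.support.toFinset.card = C.length := by
  have h : C.support.toFinset = C.support.tail.toFinset := by
    ext x
    rw [List.mem_toFinset, List.mem_toFinset, Walk.mem_support_iff]
    refine ⟨?_, Or.inr⟩
    rintro (rfl | hx)
    · exact C.end_mem_tail_support hC.not_nil
    · exact hx
  rw [h, List.toFinset_card_of_nodup hC.support_nodup, List.length_tail, Walk.length_support]
  rfl

/-- In a cycle of length at most the girth, a vertex of the cycle is close to the starting vertex
if it is joined to it by a short path not contained in the cycle. -/
theorem Walk.IsCycle.exists_getVert_eq {V : Type*} {G : SimpleGraph V} {g : ℕ}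
    (hg : (g : ℕ∞) ≤ G.egirth) {y z : V} {C : G.Walk y y} (hC : C.IsCycle) (hlen : C.length = g)
    (hz : z ∈ C.support) (hyz : y ≠ z) {q : G.Walk y z} (hq : q.IsPath) :
    ∃ l, C.getVert l = z ∧ (g ≤ l + q.length ∨ l = q.length) ∧
      (l ≤ q.length ∨ l + q.length = g) ∧
      (¬ (q.support ⊆ C.support) → g ≤ l + q.length ∧ l ≤ q.length) := by
  classical
  have hp1 := hC.isPath_takeUntil hz
  have hp2 : (C.dropUntil z hz).IsPath := by
    rw [← take_spec C hz] at hC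
    exact hC.isPath_of_append_right (not_nil_of_ne hyz)
  have hadd := congrArg Walk.length (C.take_spec hz)
  rw [Walk.length_append, hlen] at hadd
  -- Each of the two arcs of `C` between `y` and `z` either is `q` or closes up with `q` to length
  -- at least `g`. The witness `l` is the length of the first arc.
  have h1 : C.takeUntil z hz = q ∨ g ≤ (C.takeUntil z hz).length + q.length := by
    by_contra! h
    exact h.1 (hp1.eq_of_length_add_lt_egirth hg hq h.2)
  have h2 : (C.dropUntil z hz).reverse = q ∨ g ≤ (C.dropUntil z hz).length + q.length := by
    by_contra! h
    exact h.1 (hp2.reverse.eq_of_length_add_lt_egirth hg hq (by simpa using h.2))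
  refine ⟨(C.takeUntil z hz).length, C.getVert_length_takeUntil hz, ?_, ?_, fun hs => ?_⟩
  · exact h1.symm.imp_right fun h => by rw [h]
  · rcases h2 with h | h
    · have := congrArg Walk.length h
      rw [Walk.length_reverse] at this
      omega
    · omega
  · have h1' : g ≤ (C.takeUntil z hz).length + q.length := h1.resolve_left fun h =>
      hs (h ▸ C.support_takeUntil_subset_support hz)
    have h2' : g ≤ (C.dropUntil z hz).length + q.length := h2.resolve_left fun h => hs (by
      rw [← h, Walk.support_reverse]
      exact fun a ha => C.support_dropUntil_subset_support hz (List.mem_reverse.1 ha))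
    omega

variable {V : Type*} [Fintype V] [DecidableEq V] {G : SimpleGraph V} [DecidableRel G.Adj]

theorem Walk.IsCycle.two_le_card_neighborFinset_inter {v x : V} {C : G.Walk v v} (hC : C.IsCycle)
    (hx : x ∈ C.support) : 2 ≤ (G.neighborFinset x ∩ C.support.toFinset).card := by
  rw [← hC.ncard_neighborSet_toSubgraph_eq_two hx, ← Set.ncard_coe_finset]
  refine Set.ncard_le_ncard (fun y hy => ?_) (Finset.finite_toSet _)
  rw [Subgraph.mem_neighborSet] at hy
  simpa using ⟨hy.adj_sub, (C.mem_verts_toSubgraph).1 hy.snd_mem⟩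

theorem Walk.IsCycle.card_neighborFinset_inter_le_two {g : ℕ} (hg4 : 4 ≤ g)
    (hg : (g : ℕ∞) ≤ G.egirth) {v : V} {C : G.Walk v v} (hC : C.IsCycle) (hlen : C.length = g)
    (x : V) : (G.neighborFinset x ∩ C.support.toFinset).card ≤ 2 := by
  by_cases hx : x ∈ C.support
  · have hC' := hC.rotate hx
    refine (Finset.card_le_card (t := {(C.rotate x hx).getVert 1, (C.rotate x hx).getVert (g - 1)})
      fun z hz => ?_).trans Finset.card_le_two
    simp only [Finset.mem_inter, mem_neighborFinset, List.mem_toFinset] at hz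
    have hz' : z ∈ (C.rotate x hx).support := (C.mem_support_rotate_iff x hx).2 hz.2
    obtain ⟨l, hl, h1, h2, -⟩ := hC'.exists_getVert_eq hg (by simpa using hlen) hz' hz.1.ne
      (q := Walk.cons hz.1 Walk.nil) (by simp [Walk.cons_isPath_iff, hz.1.ne])
    simp only [Walk.length_cons, Walk.length_nil] at h1 h2
    have hl' : l = 1 ∨ l = g - 1 := by omega
    rcases hl' with rfl | rfl <;> simp [hl]
  · rcases (G.neighborFinset x ∩ C.support.toFinset).eq_empty_or_nonempty with h0 | ⟨y, hy⟩
    · simp [h0]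
    simp only [Finset.mem_inter, mem_neighborFinset, List.mem_toFinset] at hy
    have hC' := hC.rotate hy.2
    refine (Finset.card_le_card (t := {y, (C.rotate y hy.2).getVert 2})
      fun z hz => ?_).trans Finset.card_le_two
    simp only [Finset.mem_inter, mem_neighborFinset, List.mem_toFinset] at hz
    by_cases hyz : y = z
    · simp [hyz]
    have hz' : z ∈ (C.rotate y hy.2).support := (C.mem_support_rotate_iff y hy.2).2 hz.2
    obtain ⟨l, hl, -, -, h⟩ := hC'.exists_getVert_eq hg (by simpa using hlen) hz' hyz
      (q := Walk.cons hy.1.symm (Walk.cons hz.1 Walk.nil))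
      (by simp [Walk.cons_isPath_iff, hz.1.ne, hy.1.ne', hyz])
    -- The path `y, x, z` leaves `C`, so `g ≤ l + 2` and `l ≤ 2`; with `g ≥ 4` this forces `l = 2`.
    have h := h fun hs => hx ((C.mem_support_rotate_iff y hy.2).1 (hs (by simp)))
    simp only [Walk.length_cons, Walk.length_nil] at h
    obtain rfl : l = 2 := by omega
    simp [hl]

/-! ### Cyclic edge cuts -/

theorem encard_edgesBetween_compl (X : Finset V) :
    (G.edgesBetween (X : Set V) (X : Set V)ᶜ).encard = G.boundarySize X := by
  have h : G.edgesBetween (X : Set V) (X : Set V)ᶜ =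
      (fun p : (_ : V) × V => s(p.1, p.2)) '' (X.sigma fun x => G.neighborFinset x \ X) := by
    ext e
    constructor
    · rintro ⟨x, hx, y, hy, hxy, rfl⟩
      exact ⟨⟨x, y⟩, by simpa using ⟨hx, hxy, hy⟩, rfl⟩
    · rintro ⟨⟨x, y⟩, hp, rfl⟩
      simp only [Finset.mem_coe, Finset.mem_sigma, Finset.mem_sdiff, mem_neighborFinset] at hp
      exact ⟨x, hp.1, y, hp.2.2, hp.2.1, rfl⟩
  rw [h, Set.InjOn.encard_image, Set.encard_coe_eq_coe_finsetCard, Finset.card_sigma, boundarySize]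
  rintro ⟨x, y⟩ hp ⟨x', y'⟩ hp' hpp
  simp only [Finset.mem_coe, Finset.mem_sigma, Finset.mem_sdiff, mem_neighborFinset] at hp hp'
  rcases Sym2.eq_iff.1 hpp with ⟨rfl, rfl⟩ | ⟨rfl, rfl⟩
  · rfl
  · exact absurd hp'.1 hp.2.2

theorem Walk.IsCycle.boundarySize_support {d g : ℕ} (hreg : G.IsRegularOfDegree d) (hg4 : 4 ≤ g)
    (hg : (g : ℕ∞) ≤ G.egirth) {v : V} {C : G.Walk v v} (hC : C.IsCycle) (hlen : C.length = g) :
    G.boundarySize C.support.toFinset = (d - 2) * g := by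
  have h : ∀ x ∈ C.support.toFinset, (G.neighborFinset x \ C.support.toFinset).card = d - 2 := by
    intro x hx
    have h1 := hC.two_le_card_neighborFinset_inter (List.mem_toFinset.1 hx)
    have h2 := hC.card_neighborFinset_inter_le_two hg4 hg hlen x
    have h3 := Finset.card_sdiff_add_card_inter (G.neighborFinset x) C.support.toFinset
    rw [card_neighborFinset_eq_degree, hreg x] at h3
    omega
  rw [boundarySize, Finset.sum_congr rfl h, Finset.sum_const, hC.card_support_toFinset, hlen,
    smul_eq_mul, mul_comm]

omit [Fintype V] [DecidableEq V] [DecidableRel G.Adj] in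
theorem deleteEdges_edgesBetween_compl_adj {X : Set V} {x y : V} :
    (G.deleteEdges (G.edgesBetween X Xᶜ)).Adj x y ↔ G.Adj x y ∧ (x ∈ X ↔ y ∈ X) := by
  rw [deleteEdges_adj]
  refine and_congr_right fun hxy => ?_
  constructor
  · intro h
    by_contra hne
    by_cases hx : x ∈ X
    · exact h ⟨x, hx, y, fun hy => hne (iff_of_true hx hy), hxy, rfl⟩
    · exact h ⟨y, by tauto, x, hx, hxy.symm, Sym2.eq_swap⟩
  · rintro h ⟨a, ha, b, hb, -, hab⟩
    rcases Sym2.eq_iff.1 hab with ⟨rfl, rfl⟩ | ⟨rfl, rfl⟩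
    · exact hb (h.1 ha)
    · exact hb (h.2 ha)

theorem isCyclicEdgeCut_edgesBetween_compl {X : Finset V} (hX : X.Nonempty) (hXc : X ≠ Finset.univ)
    (h1 : ∀ x ∈ X, 2 ≤ (G.neighborFinset x ∩ X).card)
    (h2 : ∀ x ∉ X, 2 ≤ (G.neighborFinset x \ X).card) :
    G.IsCyclicEdgeCut (G.edgesBetween (X : Set V) (X : Set V)ᶜ) := by
  refine ⟨?_, fun hpre => ?_, ConnectedComponent.exists_isCycle fun x => ?_⟩
  · rintro e ⟨x, -, y, -, hxy, rfl⟩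
    exact hxy
  · obtain ⟨x, hx⟩ := hX
    obtain ⟨y, hy⟩ : ∃ y, y ∉ X := by
      by_contra! h
      exact hXc (Finset.eq_univ_of_forall h)
    obtain ⟨w⟩ := hpre x y
    have key : ∀ {a b} (_ : (G.deleteEdges (G.edgesBetween (X : Set V) (X : Set V)ᶜ)).Walk a b),
        a ∈ X → b ∈ X := by
      intro a b w
      induction w with
      | nil => exact id
      | cons h _ ih => exact fun ha => ih ((deleteEdges_edgesBetween_compl_adj.1 h).2.1 ha)
    exact hy (key w hx)
  · simp only [deleteEdges_edgesBetween_compl_adj, Finset.mem_coe]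
    by_cases hx : x ∈ X
    · obtain ⟨a, b, ha, hb, hab⟩ := Finset.one_lt_card_iff.1 (h1 x hx)
      simp only [Finset.mem_inter, mem_neighborFinset] at ha hb
      exact ⟨a, b, hab, ⟨ha.1, iff_of_true hx ha.2⟩, hb.1, iff_of_true hx hb.2⟩
    · obtain ⟨a, b, ha, hb, hab⟩ := Finset.one_lt_card_iff.1 (h2 x hx)
      simp only [Finset.mem_sdiff, mem_neighborFinset] at ha hb
      exact ⟨a, b, hab, ⟨ha.1, iff_of_false hx ha.2⟩, hb.1, iff_of_false hx hb.2⟩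

theorem Walk.IsCycle.isCyclicEdgeCut {d g : ℕ} (hd : 4 ≤ d) (hreg : G.IsRegularOfDegree d)
    (hg4 : 4 ≤ g) (hg : (g : ℕ∞) ≤ G.egirth) {v : V} {C : G.Walk v v} (hC : C.IsCycle)
    (hlen : C.length = g) :
    G.IsCyclicEdgeCut
      (G.edgesBetween (C.support.toFinset : Set V) (C.support.toFinset : Set V)ᶜ) := by
  have h3 : ∀ x, (G.neighborFinset x \ C.support.toFinset).card + 2 ≥ d := fun x => by
    have h := Finset.card_sdiff_add_card_inter (G.neighborFinset x) C.support.toFinset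
    rw [card_neighborFinset_eq_degree, hreg x] at h
    have := hC.card_neighborFinset_inter_le_two hg4 hg hlen x
    omega
  refine isCyclicEdgeCut_edgesBetween_compl ⟨v, by simp⟩ (fun h => ?_)
    (fun x hx => hC.two_le_card_neighborFinset_inter (List.mem_toFinset.1 hx)) fun x _ => ?_
  · have := h3 v
    rw [h, Finset.sdiff_eq_empty_iff_subset.2 (Finset.subset_univ _), Finset.card_empty] at this
    omega
  · have := h3 x
    omega

/-- `X` is a component of `G - S`, or its complement if the component exceeds half of the vertices.
The complement contains another component, so either choice contains a cycle, whose vertex set is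
`F`. -/
theorem IsCyclicEdgeCut.exists_subset_support {S : Set (Sym2 V)} (hS : G.IsCyclicEdgeCut S) :
    ∃ X F : Finset V, F ⊆ X ∧ F.Nonempty ∧ (∀ x ∈ F, 2 ≤ (G.neighborFinset x ∩ F).card) ∧
      2 * X.card ≤ Fintype.card V ∧ (G.boundarySize X : ℕ∞) ≤ S.encard := by
  classical
  obtain ⟨-, hpre, hcyc⟩ := hS
  have hF : ∀ c : (G.deleteEdges S).ConnectedComponent, ∃ F : Finset V, (∀ x ∈ F, x ∈ c) ∧
      F.Nonempty ∧ ∀ x ∈ F, 2 ≤ (G.neighborFinset x ∩ F).card := by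
    intro c
    obtain ⟨v, hv, w, hw⟩ := hcyc c
    have hw' := hw.mapLe (G.deleteEdges_le S)
    refine ⟨w.support.toFinset, fun x hx => ?_, ⟨v, by simp⟩, fun x hx => ?_⟩
    · have hr : (G.deleteEdges S).Reachable v x := ⟨w.takeUntil x (List.mem_toFinset.1 hx)⟩
      have hv' : (G.deleteEdges S).connectedComponentMk v = c := hv
      exact (ConnectedComponent.sound hr).symm.trans hv'
    · have h := hw'.two_le_card_neighborFinset_inter (x := x) (by simpa using hx)
      simpa using h
  simp only [Preconnected, not_forall] at hpre
  obtain ⟨u, v, huv⟩ := hpre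
  set c := (G.deleteEdges S).connectedComponentMk u with hc
  set c' := (G.deleteEdges S).connectedComponentMk v with hc'
  have hcc : c ≠ c' := fun h => huv (ConnectedComponent.exact h)
  let X : Finset V := Finset.univ.filter fun x => (G.deleteEdges S).connectedComponentMk x = c
  have hXS : (G.boundarySize X : ℕ∞) ≤ S.encard := by
    rw [← encard_edgesBetween_compl]
    refine Set.encard_le_encard ?_
    rintro e ⟨x, hx, y, hy, hxy, rfl⟩
    by_contra he
    have hadj : (G.deleteEdges S).Adj x y := (deleteEdges_adj ..).2 ⟨hxy, he⟩
    have hx' : (G.deleteEdges S).connectedComponentMk x = c := by simpa [X] using hx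
    refine hy ?_
    simpa [X] using (ConnectedComponent.sound hadj.reachable).symm.trans hx'
  obtain ⟨F, hFc, hF0, hF2⟩ := hF c
  obtain ⟨F', hFc', hF0', hF2'⟩ := hF c'
  rcases le_or_gt (2 * X.card) (Fintype.card V) with h | h
  · exact ⟨X, F, fun x hx => Finset.mem_filter.2 ⟨Finset.mem_univ x, hFc x hx⟩, hF0, hF2, h, hXS⟩
  · refine ⟨Xᶜ, F', fun x hx => ?_, hF0', hF2', ?_, by rwa [boundarySize_compl]⟩
    · have h1 : (G.deleteEdges S).connectedComponentMk x = c' := hFc' x hx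
      simp [X, h1, hcc.symm]
    · rw [Finset.card_compl]
      omega

end SimpleGraph

theorem mainTheorem3 {V : Type*} [Fintype V] [DecidableEq V] (G : SimpleGraph V)
    [DecidableRel G.Adj] (d g : ℕ) (hd : 5 ≤ d) (hreg : G.IsRegularOfDegree d)
    (hgirth : G.girth = g) (hg : 4 ≤ g)
    (hlam : G.secondLargestEigenvalue < d)
    (hspec : 2 * ((d : ℝ) - 2) * g / (d - G.secondLargestEigenvalue) ≤
      mooreBound ((d : ℝ) - 2 / (((g / 2 : ℕ) : ℝ) - 1)) g) :
    G.cyclicEdgeConnectivity = (((d - 2) * g : ℕ) : ℕ∞) ∧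
      ∃ (v : V) (C : G.Walk v v), C.IsCycle ∧ C.length = g ∧
        G.IsCyclicEdgeCut (G.edgesBetween {x | x ∈ C.support} {x | x ∈ C.support}ᶜ) ∧
        (G.edgesBetween {x | x ∈ C.support} {x | x ∈ C.support}ᶜ).encard =
          (((d - 2) * g : ℕ) : ℕ∞) := by
  -- The natural-number girth of an acyclic graph is 0 by convention, so `g ≥ 4` provides a cycle.
  have hacyc : ¬ G.IsAcyclic := fun h => by
    rw [← SimpleGraph.girth_eq_zero] at h
    omega
  have hegirth : (g : ℕ∞) ≤ G.egirth := SimpleGraph.le_egirth.2 fun a w hw => by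
    rw [← hgirth]
    exact_mod_cast SimpleGraph.girth_le_length hw
  obtain ⟨v, C, hC, hlen⟩ := SimpleGraph.exists_girth_eq_length.2 hacyc
  have hlen : C.length = g := hlen.symm.trans hgirth
  have hsupp : {x | x ∈ C.support} = (C.support.toFinset : Set V) := by
    ext x
    simp
  have hcut := hC.isCyclicEdgeCut (by omega) hreg hg hegirth hlen
  have hcard := SimpleGraph.encard_edgesBetween_compl (G := G) C.support.toFinset
  rw [hC.boundarySize_support hreg hg hegirth hlen] at hcard
  rw [← hsupp] at hcut hcard
  refine ⟨le_antisymm ?_ ?_, v, C, hC, hlen, hcut, hcard⟩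
  · rw [← hcard]
    exact iInf₂_le _ hcut
  · refine le_iInf₂ fun S hS => ?_
    obtain ⟨X, F, hFX, hF0, hF, hX, hle⟩ := hS.exists_subset_support
    refine le_trans ?_ hle
    exact_mod_cast hreg.sub_two_mul_le_boundarySize hd hegirth hg hlam hspec hFX hF0 hF hX
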